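/- Let $m\ge 2$ and let $\mathbb{R}_m=C\ell_{0,m}$ be the real Clifford algebra with generators $e_1,\dots,e_m$, $e_j^2=-1$, $e_je_k=-e_ke_j$ for $j\ne k$, endowed with the Euclidean topology of $\mathbb{R}^{2^m}$. Let $\mathbb{R}^{m+1}\subset\mathbb{R}_m$ be the space of paravectors $x=x_0+\sum_{j=1}^m x_je_j$ ($x_0,\dots,x_m\in\mathbb{R}$), put $\mathrm{Im}(x)=\sum_{j=1}^m x_je_j$, $|\mathrm{Im}(x)|=(\sum_{j=1}^m x_j^2)^{1/2}$, and $\mathbb{S}^{m-1}=\{I\in\mathbb{R}^{m+1}: I^2=-1\}$. For $I\in\mathbb{S}^{m-1}$ let $\mathbb{C}_I=\{\alpha+I\beta:\alpha,\beta\in\mathbb{R}\}$. Let $D\subset\mathbb{C}$ be invariant under complex conjugation and let $$\Omega=\{\alpha+I\beta:\ \alpha,\beta\in\mathbb{R},\ \alpha+i\beta\in D,\ I\in\mathbb{S}^{m-1}\}\subset\mathbb{R}^{m+1}.$$ Assume that $\Omega$ is non-empty, open in $\mathbb{R}^{m+1}$, connected, and $\Omega\cap\mathbb{R}\ne\emptyset$.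 Put $\Omega_*=\Omega\setminus\mathbb{R}$, $\Omega_I=\Omega\cap\mathbb{C}_I$, and $\phi_I:D\to\Omega_I$, $\phi_I(\alpha+i\beta)=\alpha+I\beta$. Let $f:\Omega\to\mathbb{R}_m$ be a function, and let $f_*=f|_{\Omega_*}$, $f_I=f|_{\Omega_I}$. Differentiability classes are in the real sense, and the following notation is used. * If $f_I\circ\phi_I$ is of class $C^1$ on $D$, then $\overline\partial_I f_I:\Omega_I\to\mathbb{R}_m$ is defined by $\overline\partial_I f_I(\phi_I(z))=\frac12\big(\frac{\partial}{\partial\alpha}+I\frac{\partial}{\partial\beta}\big)(f_I\circ\phi_I)(z)$ for $z=\alpha+i\beta\in D$. * $f$ is *slice monogenic* if it is of class $C^1$ on $\Omega$ and $\overline\partial_I f_I=0$ on $\Omega_I$ for all $I\in\mathbb{S}^{m-1}$. * $f$ is *slice-by-slice continuous* if $f_I$ is continuous for all $I\in\mathbb{S}^{m-1}$, and *slice-by-slice $C^1$* if $f_I\circ\phi_I$ is of class $C^1$ on $D$ for all $I\in\mathbb{S}^{m-1}$. * For $g$ of class $C^1$ on $\Omega_*$, $\overline\vartheta_m g(x)=\frac12\Big(\frac{\partial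 g}{\partial x_0}(x)+\frac{\mathrm{Im}(x)}{|\mathrm{Im}(x)|^2}\sum_{h=1}^m x_h\frac{\partial g}{\partial x_h}(x)\Big)$. * For $g$ of class $C^1$ on $\Omega$, $G_m g(x)=|\mathrm{Im}(x)|^2\frac{\partial g}{\partial x_0}(x)+\mathrm{Im}(x)\sum_{h=1}^m x_h\frac{\partial g}{\partial x_h}(x)$. * A *stem function* is a function $F=F_1+iF_2:D\to\mathbb{R}_m\otimes_{\mathbb{R}}\mathbb{C}$, with $F_1,F_2:D\to\mathbb{R}_m$, such that $F_1(\overline z)=F_1(z)$ and $F_2(\overline z)=-F_2(z)$ for all $z\in D$. It induces the slice function $\mathcal{I}(F):\Omega\to\mathbb{R}_m$, $\mathcal{I}(F)(\alpha+I\beta)=F_1(\alpha+i\beta)+I\,F_2(\alpha+i\beta)$ for $\alpha+i\beta\in D$, $I\in\mathbb{S}^{m-1}$; a slice function is induced by exactly one stem function. If $f=\mathcal{I}(F)$ with $F$ of class $C^1$, then $\frac{\partial f}{\partial x^c}=\mathcal{I}\big(\frac{\partial F}{\partial\overline z}\big)$, where $\frac{\partial F}{\partial\overline z}=\frac12\Big(\big(\frac{\partial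 F_1}{\partial\alpha}-\frac{\partial F_2}{\partial\beta}\big)+i\big(\frac{\partial F_1}{\partial\beta}+\frac{\partial F_2}{\partial\alpha}\big)\Big)$. Then the following assertions are equivalent. * (a) $f$ is slice monogenic. * (a′) $f$ is slice-by-slice $C^1$ and $\overline\partial_I f_I=0$ on $\Omega_I$ for all $I\in\mathbb{S}^{m-1}$. * (b) $f$ is continuous on $\Omega$, $f_*$ is of class $C^1$ on $\Omega_*$, and $\overline\vartheta_m f_*=0$ on $\Omega_*$. * (b′) $f$ is slice-by-slice continuous, $f_*$ is of class $C^1$ on $\Omega_*$, and $\overline\vartheta_m f_*=0$ on $\Omega_*$. * (c) $f$ is of class $C^1$ on $\Omega$ and $\overline\vartheta_m f_*=0$ on $\Omega_*$. * (d) $f$ is of class $C^1$ on $\Omega$ and $G_m f=0$ on $\Omega$. * (e) $f$ is a slice function induced by a stem function of class $C^1$, and $\frac{\partial f}{\partial x^c}=0$ on $\Omega$. -/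

import Mathlib

noncomputable section

namespace SliceMonogenic

/-! ### The Clifford algebra `ℝ_m = Cℓ_{0,m}` -/

/-- The negative definite form `v ↦ -∑ v_j²` on `ℝ^m`. -/
def form (m : ℕ) : QuadraticForm ℝ (Fin m → ℝ) :=
  QuadraticMap.weightedSumSquares ℝ (fun _ : Fin m => (-1 : ℝ))

/-- The Clifford algebra `ℝ_m = Cℓ_{0,m}`: the generators anticommute and square to `-1`. -/
abbrev Cl (m : ℕ) : Type := CliffordAlgebra (form m)

/-- The generators `e_1, …, e_m` (indexed by `Fin m`). -/
def gen {m : ℕ} (j : Fin m) : Cl m := CliffordAlgebra.ι (form m) (Pi.single j 1)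

/-- The standard real vector basis `(e_K)_K` of `ℝ_m`, indexed by the subsets `K` of the index
set of the generators; it corresponds to the basis `e_{k_1} ∧ ⋯ ∧ e_{k_s}` of the exterior
algebra under the canonical linear isomorphism. -/
def stdBasis (m : ℕ) : Module.Basis (Finset (Fin m)) ℝ (Cl m) :=
  letI : Invertible (2 : ℝ) := invertibleOfNonzero two_ne_zero
  (Pi.basisFun ℝ (Fin m)).ExteriorAlgebra.map (CliffordAlgebra.equivExterior (form m)).symm

/-- Coordinates in the standard basis, identifying `ℝ_m` with `ℝ^(2^m)`. -/
def coords (m : ℕ) : Cl m ≃ₗ[ℝ] EuclideanSpace ℝ (Finset (Fin m)) :=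
  (stdBasis m).equivFun.trans (WithLp.linearEquiv 2 ℝ (Finset (Fin m) → ℝ)).symm

/-- The Euclidean norm of `ℝ_m = ℝ^(2^m)`. -/
instance (m : ℕ) : NormedAddCommGroup (Cl m) :=
  NormedAddCommGroup.induced (Cl m) (EuclideanSpace ℝ (Finset (Fin m))) (coords m)
    (coords m).injective

instance (m : ℕ) : NormedSpace ℝ (Cl m) :=
  NormedSpace.induced ℝ (Cl m) (EuclideanSpace ℝ (Finset (Fin m))) (coords m)

instance (m : ℕ) : FiniteDimensional ℝ (Cl m) := Module.Finite.of_basis (stdBasis m)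

/-! ### Paravectors -/

/-- The space `ℝ^{m+1}` of paravectors, in the coordinates `x_0, x_1, …, x_m`. -/
abbrev Paravector (m : ℕ) : Type := EuclideanSpace ℝ (Fin (m + 1))

/-- The inclusion `ℝ^{m+1} ⊆ ℝ_m`, `x ↦ x_0 + ∑ x_j e_j`. -/
def toCl (m : ℕ) : Paravector m →ₗ[ℝ] Cl m where
  toFun x := algebraMap ℝ (Cl m) (x 0) + ∑ j : Fin m, x j.succ • gen j
  map_add' x y := by
    simp only [PiLp.add_apply, map_add, add_smul, Finset.sum_add_distrib]
    abel
  map_smul' c x := by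
    simp only [PiLp.smul_apply, smul_eq_mul, map_mul, mul_smul, RingHom.id_apply, smul_add,
      Finset.smul_sum, Algebra.smul_def c (algebraMap ℝ (Cl m) (x 0))]

/-- The vector of `ℝ^{m+1}` whose `h`-th coordinate is `1` and whose other coordinates are `0`. -/
def unit {m : ℕ} (h : Fin (m + 1)) : Paravector m := EuclideanSpace.single h (1 : ℝ)

/-- `Im(x) = x - x_0`. -/
def im {m : ℕ} (x : Paravector m) : Paravector m := x - x 0 • unit 0

/-- The real axis `ℝ` in `ℝ^{m+1}`. -/
def realAxis (m : ℕ) : Set (Paravector m) := {x | im x = 0}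

/-- The sphere `𝕊^{m-1}` of paravector imaginary units. -/
def imUnits (m : ℕ) : Set (Paravector m) := {I | toCl m I ^ 2 = -1}

/-- `φ_I(α + iβ) = α + Iβ`. -/
def phi {m : ℕ} (I : Paravector m) (z : ℂ) : Paravector m := z.re • unit 0 + z.im • I

/-- The slice `ℂ_I = {α + Iβ : α, β ∈ ℝ}`. -/
def sliceC {m : ℕ} (I : Paravector m) : Set (Paravector m) := Set.range (phi I)

/-- The circularization `Ω_{m,E}` of `E ⊆ ℂ` in `ℝ^{m+1}`. -/
def circularization (m : ℕ) (E : Set ℂ) : Set (Paravector m) :=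
  {x | ∃ z ∈ E, ∃ I ∈ imUnits m, x = phi I z}

/-! ### Differential operators -/

/-- The partial derivative `∂g/∂x_h`. -/
def partialDeriv {m : ℕ} (h : Fin (m + 1)) (g : Paravector m → Cl m) (x : Paravector m) : Cl m :=
  fderiv ℝ g x (unit h)

/-- `∂_α h` for a function `h` of `z = α + iβ`. -/
def dAlpha {m : ℕ} (h : ℂ → Cl m) (z : ℂ) : Cl m := fderiv ℝ h z 1

/-- `∂_β h` for a function `h` of `z = α + iβ`. -/
def dBeta {m : ℕ} (h : ℂ → Cl m) (z : ℂ) : Cl m := fderiv ℝ h z Complex.I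

/-- The value of `∂̄_I f_I` at the point `φ_I(z)` of `Ω_I`, that is
`(1/2) (∂_α + I ∂_β)(f_I ∘ φ_I)` at `z`. -/
def dbar {m : ℕ} (I : Paravector m) (f : Paravector m → Cl m) (z : ℂ) : Cl m :=
  (1 / 2 : ℝ) • (dAlpha (f ∘ phi I) z + toCl m I * dBeta (f ∘ phi I) z)

/-- `ϑ̄_m = (1/2) (∂/∂x_0 + (Im(x)/|Im(x)|²) ∑_{h=1}^m x_h ∂/∂x_h)`. -/
def thetaBar {m : ℕ} (g : Paravector m → Cl m) (x : Paravector m) : Cl m :=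
  (1 / 2 : ℝ) • (partialDeriv 0 g x +
    (‖im x‖ ^ 2)⁻¹ • (toCl m (im x) * ∑ h : Fin m, x h.succ • partialDeriv h.succ g x))

/-- `G_m = |Im(x)|² ∂/∂x_0 + Im(x) ∑_{h=1}^m x_h ∂/∂x_h`. -/
def opG {m : ℕ} (g : Paravector m → Cl m) (x : Paravector m) : Cl m :=
  ‖im x‖ ^ 2 • partialDeriv 0 g x +
    toCl m (im x) * ∑ h : Fin m, x h.succ • partialDeriv h.succ g x

/-! ### Slice functions

A function `F = F_1 + i F_2` with values in `ℝ_m ⊗ ℂ = ℝ_m ⊕ i ℝ_m` is given by the pair of its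
components `F_1`, `F_2`. -/

/-- `F` is a stem function on `D`: `F_1(z̄) = F_1(z)` and `F_2(z̄) = -F_2(z)`. -/
def IsStem {m : ℕ} (D : Set ℂ) (F : ℂ → Cl m × Cl m) : Prop :=
  ∀ z ∈ D, (F (starRingEnd ℂ z)).1 = (F z).1 ∧ (F (starRingEnd ℂ z)).2 = -(F z).2

/-- `f` is the slice function induced by `F`, i.e. `f = 𝓘(F)`:
`F` is a stem function on `D` and `f(α + Iβ) = F_1(α + iβ) + I F_2(α + iβ)`. -/
def IsInducedBy {m : ℕ} (D : Set ℂ) (f : Paravector m → Cl m) (F : ℂ → Cl m × Cl m) : Prop :=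
  IsStem D F ∧ ∀ z ∈ D, ∀ I ∈ imUnits m, f (phi I z) = (F z).1 + toCl m I * (F z).2

/-- `∂F/∂z̄ = (1/2) ((∂_α F_1 - ∂_β F_2) + i (∂_β F_1 + ∂_α F_2))`. -/
def stemDbar {m : ℕ} (F : ℂ → Cl m × Cl m) (z : ℂ) : Cl m × Cl m :=
  ((1 / 2 : ℝ) • (dAlpha (fun w => (F w).1) z - dBeta (fun w => (F w).2) z),
   (1 / 2 : ℝ) • (dBeta (fun w => (F w).1) z + dAlpha (fun w => (F w).2) z))

/-- `f` is induced by a stem function `F` of class `C¹` (necessarily unique on `D`), and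
`g = ∂f/∂x^c` is the slice function `𝓘(∂F/∂z̄)`. -/
def HasSliceDbar {m : ℕ} (D : Set ℂ) (f g : Paravector m → Cl m) : Prop :=
  ∃ F : ℂ → Cl m × Cl m, ContDiffOn ℝ 1 F D ∧ IsInducedBy D f F ∧ IsInducedBy D g (stemDbar F)

/-! ### Slice-by-slice conditions and slice monogenicity -/

/-- `f_I : Ω ∩ ℂ_I → ℝ_m` is continuous for every `I`. -/
def SliceContinuous {m : ℕ} (Ω : Set (Paravector m)) (f : Paravector m → Cl m) : Prop :=
  ∀ I ∈ imUnits m, ContinuousOn f (Ω ∩ sliceC I)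

/-- `f_I ∘ φ_I : D → ℝ_m` is of class `C¹` for every `I`. -/
def SliceC1 {m : ℕ} (D : Set ℂ) (f : Paravector m → Cl m) : Prop :=
  ∀ I ∈ imUnits m, ContDiffOn ℝ 1 (f ∘ phi I) D

/-- `f` is slice monogenic on `Ω`, the circularization of `D`. -/
def IsSliceMonogenic {m : ℕ} (D : Set ℂ) (Ω : Set (Paravector m)) (f : Paravector m → Cl m) :
    Prop :=
  ContDiffOn ℝ 1 f Ω ∧ ∀ I ∈ imUnits m, ∀ z ∈ D, dbar I f z = 0

end SliceMonogenic

end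

/-!
Off the real axis `ϑ̄_m f` restricts to `∂̄_I f_I` on every slice (`thetaBar_phi`) and
`G_m f = 2 |Im(x)|² ϑ̄_m f` (`opG_eq`), so the conditions on `C¹` functions imply each other and
imply the weaker conditions by bookkeeping. The substance lies in three implications that lead from
the weakest condition, slice-by-slice continuity with `ϑ̄_m f = 0` off the real axis, back to the
strongest.

For `J` with `J² = -1` and a real functional `L` on `ℝ_m`, the functional `a ↦ L a - i L (J a)`
(`complexify`) turns left multiplication by `J` into multiplication by `i`. Hence
`∂_α g + J ∂_β g = 0` holds if and only if all complexified coordinates of `g` are holomorphic, and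
scalar complex analysis applies.

* Slice-by-slice continuous functions killed by `ϑ̄_m` are holomorphic on slices: on each slice the
  complexified coordinates are continuous, and holomorphic off the real axis. By Morera's theorem
  they are holomorphic (`differentiableOn_of_differentiableOn_diff_real`).
* Functions holomorphic on slices are slice functions: a fixed slice `ℂ_J` yields a candidate stem
  function through the representation formula (`stemOfSlice`), and it satisfies the Cauchy-Riemann
  equations. The slice function it induces agrees with `f` on the real axis, hence on every slice by
  the identity theorem (`isInducedBy_stemOfSlice`). Here the connectedness of `D` is used; it
  follows from that of `Ω` and from `Ω ∩ ℝ ≠ ∅`.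
* Slice functions with `∂f/∂x^c = 0` are slice monogenic: `∂̄_I f_I` is the restriction of
  `∂f/∂x^c` (`dbar_eq_of_isInducedBy`). That `f` is of class `C¹` (`IsInducedBy.contDiffOn`) is
  clear off the real axis, where `f = F_1 + (Im(x) / |Im(x)|) F_2` is composed of `C¹` maps. At a
  real point the symmetries of `F_1` and `F_2` make both terms strictly differentiable, and a
  function that is strictly differentiable at each point of an open set is of class `C¹` there.
-/

namespace SliceMonogenic

variable {m : ℕ}

/-! ### Paravectors and imaginary units -/

/-- The coordinates `x_1, …, x_m` of a paravector. -/
def imCoords (x : Paravector m) : Fin m → ℝ := fun j => x j.succ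

theorem toCl_eq_add_ι (x : Paravector m) :
    toCl m x = algebraMap ℝ (Cl m) (x 0) + CliffordAlgebra.ι (form m) (imCoords x) := by
  change algebraMap ℝ (Cl m) (x 0) + ∑ j : Fin m, x j.succ • gen j = _
  congr 1
  conv_rhs => rw [pi_eq_sum_univ' (imCoords x), map_sum]
  refine Finset.sum_congr rfl fun j _ => ?_
  rw [map_smul, gen, imCoords]

theorem form_imCoords (x : Paravector m) : form m (imCoords x) = -∑ j : Fin m, x j.succ ^ 2 := by
  simp [form, QuadraticMap.weightedSumSquares_apply, imCoords, sq]

theorem norm_sq_eq (x : Paravector m) : ‖x‖ ^ 2 = x 0 ^ 2 + ∑ j : Fin m, x j.succ ^ 2 := by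
  rw [EuclideanSpace.norm_sq_eq, Fin.sum_univ_succ]
  simp

@[simp] theorem unit_zero_apply_zero : (unit 0 : Paravector m) 0 = 1 := by simp [unit]

@[simp] theorem unit_zero_apply_succ (j : Fin m) : (unit 0 : Paravector m) j.succ = 0 := by
  simp [unit, Fin.succ_ne_zero]

@[simp] theorem im_apply_zero (x : Paravector m) : im x 0 = 0 := by simp [im]

@[simp] theorem im_apply_succ (x : Paravector m) (j : Fin m) : im x j.succ = x j.succ := by
  simp [im]

theorem toCl_mul_self_of_apply_zero {x : Paravector m} (hx : x 0 = 0) :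
    toCl m x * toCl m x = algebraMap ℝ (Cl m) (-‖x‖ ^ 2) := by
  rw [toCl_eq_add_ι, hx, map_zero, zero_add, CliffordAlgebra.ι_sq_scalar, form_imCoords,
    norm_sq_eq, hx]
  simp

theorem algebraMap_Cl_injective : Function.Injective (algebraMap ℝ (Cl m)) := by
  let _ : Invertible (2 : ℝ) := invertibleOfNonzero two_ne_zero
  exact (algebraMap ℝ (Cl m)).injective

/-- The imaginary units are the unit vectors of `{x_0 = 0}`. The grade involution of the Clifford
algebra separates the scalar part of `I ^ 2` from its vector part `2 I_0 (I - I_0)`. -/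
theorem mem_imUnits_iff {I : Paravector m} : I ∈ imUnits m ↔ I 0 = 0 ∧ ‖I‖ = 1 := by
  constructor
  · intro h
    have h0 : I 0 = 0 := by
      by_contra hne
      change toCl m I ^ 2 = -1 at h
      set v := CliffordAlgebra.ι (form m) (imCoords I) with hv
      have hvv : v * v = algebraMap ℝ (Cl m) (-∑ j : Fin m, I j.succ ^ 2) := by
        rw [hv, CliffordAlgebra.ι_sq_scalar, form_imCoords]
      have hx : toCl m I = I 0 • (1 : Cl m) + v := by
        rw [toCl_eq_add_ι, Algebra.algebraMap_eq_smul_one]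
      rw [hx] at h
      have hi := congrArg (CliffordAlgebra.involute (Q := form m)) h
      simp only [map_pow, map_add, map_smul, map_one, map_neg, hv,
        CliffordAlgebra.involute_ι] at hi
      rw [← hv, ← h] at hi
      -- `I²` and its grade involution are both `-1`; their difference is `4 I_0 v`
      have h4 : (4 * I 0) • v = 0 := by
        have : (I 0 • (1 : Cl m) + v) ^ 2 - (I 0 • (1 : Cl m) + -v) ^ 2 = (4 * I 0) • v := by
          simp only [sq, add_mul, mul_add, smul_mul_assoc, one_mul, mul_smul_comm, mul_one,
            mul_neg, neg_mul]
          module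
        rw [← this, hi, sub_self]
      have hv0 : v = 0 := by
        rcases smul_eq_zero.1 h4 with h5 | h5
        · exact absurd (by linarith) hne
        · exact h5
      rw [hv0, add_zero, smul_pow, one_pow, ← Algebra.algebraMap_eq_smul_one] at h
      have h6 : I 0 ^ 2 = -1 := by
        apply algebraMap_Cl_injective (m := m)
        rw [h]; simp
      nlinarith [sq_nonneg (I 0)]
    refine ⟨h0, ?_⟩
    change toCl m I ^ 2 = -1 at h
    rw [sq, toCl_mul_self_of_apply_zero h0] at h
    have h6 : -‖I‖ ^ 2 = -1 := by
      apply algebraMap_Cl_injective (m := m)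
      rw [h]; simp
    have h7 : ‖I‖ ^ 2 = 1 := by linarith
    exact (pow_eq_one_iff_of_nonneg (norm_nonneg _) two_ne_zero).1 h7
  · rintro ⟨h0, h1⟩
    change toCl m I ^ 2 = -1
    rw [sq, toCl_mul_self_of_apply_zero h0, h1]
    simp

theorem toCl_mul_self_of_mem_imUnits {I : Paravector m} (hI : I ∈ imUnits m) :
    toCl m I * toCl m I = -1 := by
  rw [← sq]; exact hI

theorem toCl_mul_toCl_mul {I : Paravector m} (hI : I ∈ imUnits m) (a : Cl m) :
    toCl m I * (toCl m I * a) = -a := by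
  rw [← mul_assoc, toCl_mul_self_of_mem_imUnits hI, neg_one_mul]

theorem imUnits_nonempty (hm : 0 < m) : (imUnits m).Nonempty := by
  refine ⟨unit (Fin.succ ⟨0, hm⟩), mem_imUnits_iff.2 ⟨?_, ?_⟩⟩
  · simp [unit]
  · simp [unit]

/-! ### Coordinates on the slices -/

theorem im_phi {I : Paravector m} (hI : I ∈ imUnits m) (z : ℂ) : im (phi I z) = z.im • I := by
  ext i
  have h0 := (mem_imUnits_iff.1 hI).1
  refine Fin.cases ?_ (fun j => ?_) i
  · simp [h0]
  · simp [phi]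

theorem phi_apply_zero {I : Paravector m} (hI : I ∈ imUnits m) (z : ℂ) : phi I z 0 = z.re := by
  have h0 := (mem_imUnits_iff.1 hI).1
  simp [phi, h0]

/-- The point `x_0 + i |Im(x)|` of the closed upper half plane over which `x` lies. -/
noncomputable def proj (x : Paravector m) : ℂ := ⟨x 0, ‖im x‖⟩

/-- The imaginary unit `Im(x) / |Im(x)|` of a non-real paravector; it is `0` on the real axis. -/
noncomputable def dir (x : Paravector m) : Paravector m := ‖im x‖⁻¹ • im x

theorem proj_phi {I : Paravector m} (hI : I ∈ imUnits m) (z : ℂ) :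
    proj (phi I z) = z ∨ proj (phi I z) = starRingEnd ℂ z := by
  have h1 := (mem_imUnits_iff.1 hI).2
  rcases le_total 0 z.im with h | h
  · left
    apply Complex.ext
    · exact phi_apply_zero hI z
    · simp [proj, im_phi hI, norm_smul, h1, abs_of_nonneg h]
  · right
    apply Complex.ext
    · exact phi_apply_zero hI z
    · simp [proj, im_phi hI, norm_smul, h1, abs_of_nonpos h]

theorem dir_mem_imUnits {x : Paravector m} (hx : im x ≠ 0) : dir x ∈ imUnits m := by
  refine mem_imUnits_iff.2 ⟨by simp [dir], ?_⟩
  rw [dir, norm_smul, norm_inv, norm_norm, inv_mul_cancel₀ (norm_ne_zero_iff.2 hx)]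

theorem norm_smul_dir (x : Paravector m) : ‖im x‖ • dir x = im x := by
  by_cases hx : im x = 0
  · simp [hx]
  · rw [dir, smul_smul, mul_inv_cancel₀ (norm_ne_zero_iff.2 hx), one_smul]

theorem norm_dir_le (x : Paravector m) : ‖dir x‖ ≤ 1 := by
  by_cases hx : im x = 0
  · simp [dir, hx]
  · exact (mem_imUnits_iff.1 (dir_mem_imUnits hx)).2.le

theorem phi_dir_proj (x : Paravector m) : phi (dir x) (proj x) = x := by
  simp only [phi, proj]
  rw [norm_smul_dir, im]
  abel

theorem phi_proj_of_im_eq_zero (I : Paravector m) {x : Paravector m} (hx : im x = 0) :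
    phi I (proj x) = x := by
  have : x = x 0 • unit 0 := by rwa [im, sub_eq_zero] at hx
  simp only [phi, proj, hx, norm_zero, zero_smul, add_zero]
  exact this.symm

theorem proj_mem {D : Set ℂ} (hD : ∀ z ∈ D, starRingEnd ℂ z ∈ D) {x : Paravector m}
    (hx : x ∈ circularization m D) : proj x ∈ D := by
  obtain ⟨z, hz, I, hI, rfl⟩ := hx
  rcases proj_phi hI z with h | h
  · rwa [h]
  · rw [h]; exact hD z hz

theorem phi_mem_circularization {D : Set ℂ} {z : ℂ} (hz : z ∈ D) {I : Paravector m}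
    (hI : I ∈ imUnits m) : phi I z ∈ circularization m D :=
  ⟨z, hz, I, hI, rfl⟩

theorem phi_mem_circularization_iff {D : Set ℂ} (hD : ∀ z ∈ D, starRingEnd ℂ z ∈ D) {z : ℂ}
    {I : Paravector m} (hI : I ∈ imUnits m) : phi I z ∈ circularization m D ↔ z ∈ D := by
  refine ⟨fun h => ?_, fun h => phi_mem_circularization h hI⟩
  have h1 := proj_mem hD h
  rcases proj_phi hI z with h | h
  · rwa [h] at h1
  · rw [h] at h1
    simpa using hD _ h1

theorem phi_mem_realAxis_iff {I : Paravector m} (hI : I ∈ imUnits m) {z : ℂ} :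
    phi I z ∈ realAxis m ↔ z.im = 0 := by
  have h1 : I ≠ 0 := by
    rintro rfl
    simpa using (mem_imUnits_iff.1 hI).2
  simp [realAxis, im_phi hI, h1]

/-- The map `φ_I` as a continuous linear map. -/
noncomputable def phiL (I : Paravector m) : ℂ →L[ℝ] Paravector m :=
  Complex.reCLM.smulRight (unit 0) + Complex.imCLM.smulRight I

theorem coe_phiL (I : Paravector m) : ⇑(phiL I) = phi I := by
  ext z
  simp [phiL, phi]

theorem continuous_phi (I : Paravector m) : Continuous (phi I) := by
  rw [← coe_phiL]; exact (phiL I).continuous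

theorem isOpen_of_isOpen_circularization (hm : 0 < m) {D : Set ℂ}
    (hD : ∀ z ∈ D, starRingEnd ℂ z ∈ D) (hΩ : IsOpen (circularization m D)) : IsOpen D := by
  obtain ⟨I, hI⟩ := imUnits_nonempty hm
  have : D = phi I ⁻¹' circularization m D :=
    Set.ext fun z => (phi_mem_circularization_iff hD hI).symm
  rw [this]
  exact hΩ.preimage (continuous_phi I)

/-- The linear map `x ↦ Im(x)`. -/
noncomputable def imL (m : ℕ) : Paravector m →L[ℝ] Paravector m :=
  ContinuousLinearMap.id ℝ _ - (EuclideanSpace.proj (0 : Fin (m + 1))).smulRight (unit 0)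

theorem imL_apply (x : Paravector m) : imL m x = im x := by
  simp [imL, im]

theorem im_sub (x y : Paravector m) : im (x - y) = im x - im y := by
  simp only [← imL_apply, map_sub]

theorem continuous_im : Continuous (im : Paravector m → Paravector m) := by
  have : (im : Paravector m → Paravector m) = imL m := by ext1 x; rw [imL_apply]
  rw [this]; exact (imL m).continuous

theorem norm_sq_eq_im (x : Paravector m) : ‖x‖ ^ 2 = x 0 ^ 2 + ‖im x‖ ^ 2 := by
  rw [norm_sq_eq, norm_sq_eq (im x)]
  simp

theorem continuous_proj : Continuous (proj : Paravector m → ℂ) := by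
  have : (proj : Paravector m → ℂ) = fun x => ((x 0 : ℝ) : ℂ) + ((‖im x‖ : ℝ) : ℂ) * Complex.I := by
    ext1 x
    apply Complex.ext <;> simp [proj]
  rw [this]
  have h1 : Continuous fun x : Paravector m => x 0 := by fun_prop
  have := continuous_im (m := m)
  fun_prop

/-- `D` is the union of the image of `Ω` under `proj` and of its conjugate, and these two sets
meet on the real axis. -/
theorem isPreconnected_of_circularization (hm : 0 < m) {D : Set ℂ}
    (hD : ∀ z ∈ D, starRingEnd ℂ z ∈ D) (hΩ : IsPreconnected (circularization m D))
    (hreal : (circularization m D ∩ realAxis m).Nonempty) : IsPreconnected D := by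
  obtain ⟨x, hx, hxr⟩ := hreal
  have h1 : IsPreconnected (proj '' circularization m D) :=
    hΩ.image _ continuous_proj.continuousOn
  have h2 : IsPreconnected (starRingEnd ℂ '' (proj '' circularization m D)) :=
    h1.image _ Complex.continuous_conj.continuousOn
  have hc : starRingEnd ℂ (proj x) = proj x := by
    apply Complex.ext
    · simp
    · have : im x = 0 := hxr
      simp [proj, this]
  have h3 := h1.union (proj x) (Set.mem_image_of_mem _ hx)
    (show proj x ∈ starRingEnd ℂ '' (proj '' circularization m D) from
      ⟨proj x, Set.mem_image_of_mem _ hx, hc⟩) h2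
  convert h3 using 1
  obtain ⟨I, hI⟩ := imUnits_nonempty hm
  apply Set.Subset.antisymm
  · intro z hz
    rcases proj_phi hI z with h | h
    · exact Or.inl ⟨phi I z, phi_mem_circularization hz hI, h⟩
    · exact Or.inr ⟨_, ⟨_, phi_mem_circularization hz hI, rfl⟩, by rw [h]; simp⟩
  · rintro z (⟨y, hy, rfl⟩ | ⟨_, ⟨y, hy, rfl⟩, rfl⟩)
    · exact proj_mem hD hy
    · exact hD _ (proj_mem hD hy)

/-! ### Reduction to scalar holomorphic functions -/

/-- For a real functional `L` and `J² = -1`, the map `a ↦ L a - i L (J a)`. It turns left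
multiplication by `J` into multiplication by `i`, and `L` is its real part. -/
noncomputable def complexify (L : Cl m →ₗ[ℝ] ℝ) (J : Cl m) : Cl m →L[ℝ] ℂ :=
  LinearMap.toContinuousLinearMap
    (Complex.ofRealCLM.toLinearMap ∘ₗ L -
      Complex.I • (Complex.ofRealCLM.toLinearMap ∘ₗ L ∘ₗ LinearMap.mulLeft ℝ J))

theorem complexify_apply (L : Cl m →ₗ[ℝ] ℝ) (J a : Cl m) :
    complexify L J a = (L a : ℂ) - Complex.I * (L (J * a) : ℂ) := by
  simp [complexify]

theorem re_complexify (L : Cl m →ₗ[ℝ] ℝ) (J a : Cl m) : (complexify L J a).re = L a := by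
  simp [complexify_apply]

theorem complexify_mul {J : Cl m} (hJ : J * J = -1) (L : Cl m →ₗ[ℝ] ℝ) (a : Cl m) :
    complexify L J (J * a) = Complex.I * complexify L J a := by
  rw [complexify_apply, complexify_apply, ← mul_assoc, hJ]
  simp only [neg_mul, one_mul, map_neg, Complex.ofReal_neg]
  linear_combination (L (J * a) : ℂ) * Complex.I_mul_I

theorem eq_of_forall_complexify_eq (J : Cl m) {a b : Cl m}
    (h : ∀ L : Cl m →ₗ[ℝ] ℝ, complexify L J a = complexify L J b) : a = b := by
  apply (stdBasis m).ext_elem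
  intro K
  have := congrArg Complex.re (h ((stdBasis m).coord K))
  simpa [re_complexify] using this

/-- A function with `∂_α g + J ∂_β g = 0` has holomorphic complexified coordinates. -/
theorem differentiableAt_complexify {J : Cl m} (hJ : J * J = -1) {g : ℂ → Cl m} {z : ℂ}
    (hg : DifferentiableAt ℝ g z) (h : dAlpha g z + J * dBeta g z = 0) (L : Cl m →ₗ[ℝ] ℝ) :
    DifferentiableAt ℂ (fun w => complexify L J (g w)) z := by
  have hd : HasFDerivAt (fun w => complexify L J (g w)) ((complexify L J).comp (fderiv ℝ g z)) z :=
    (complexify L J).hasFDerivAt.comp z hg.hasFDerivAt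
  rw [differentiableAt_complex_iff_differentiableAt_real]
  refine ⟨hd.differentiableAt, ?_⟩
  rw [hd.fderiv]
  simp only [ContinuousLinearMap.comp_apply, smul_eq_mul]
  change complexify L J (dBeta g z) = Complex.I * complexify L J (dAlpha g z)
  rw [← complexify_mul hJ, eq_neg_of_add_eq_zero_left h, mul_neg, ← mul_assoc, hJ]
  simp

theorem contDiffOn_of_forall_complexify {n : WithTop ℕ∞} {J : Cl m} {D : Set ℂ} (hD : IsOpen D)
    {g : ℂ → Cl m} (h : ∀ L : Cl m →ₗ[ℝ] ℝ, DifferentiableOn ℂ (fun w => complexify L J (g w)) D) :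
    ContDiffOn ℝ n g D := by
  rw [← (stdBasis m).equivFunL.comp_contDiffOn_iff, contDiffOn_pi]
  intro K
  have h1 : ContDiffOn ℝ n (fun w => complexify ((stdBasis m).coord K) J (g w)) D :=
    ((h _).contDiffOn hD).restrict_scalars ℝ
  have h2 := Complex.reCLM.contDiff.comp_contDiffOn h1
  refine h2.congr fun w _ => ?_
  simp [re_complexify]

theorem dAlpha_add_mul_dBeta_eq_zero {J : Cl m} (hJ : J * J = -1) {g : ℂ → Cl m} {z : ℂ}
    (hg : DifferentiableAt ℝ g z)
    (h : ∀ L : Cl m →ₗ[ℝ] ℝ, DifferentiableAt ℂ (fun w => complexify L J (g w)) z) :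
    dAlpha g z + J * dBeta g z = 0 := by
  apply eq_of_forall_complexify_eq J
  intro L
  have hd : HasFDerivAt (fun w => complexify L J (g w)) ((complexify L J).comp (fderiv ℝ g z)) z :=
    (complexify L J).hasFDerivAt.comp z hg.hasFDerivAt
  have h1 := (differentiableAt_complex_iff_differentiableAt_real.1 (h L)).2
  rw [hd.fderiv] at h1
  simp only [ContinuousLinearMap.comp_apply, smul_eq_mul] at h1
  change complexify L J (dBeta g z) = Complex.I * complexify L J (dAlpha g z) at h1
  rw [map_add, complexify_mul hJ, h1, ← mul_assoc, Complex.I_mul_I]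
  simp

open Complex Interval in
/-- Rectangle integrals vanish: a rectangle is cut along the real axis into two rectangles on whose
interiors `h` is holomorphic. Morera's theorem then applies. -/
theorem differentiableOn_of_differentiableOn_diff_real {D : Set ℂ} (hD : IsOpen D) {h : ℂ → ℂ}
    (hc : ContinuousOn h D) (hd : DifferentiableOn ℂ h (D \ {z | z.im = 0})) :
    DifferentiableOn ℂ h D := by
  rw [← isConservativeOn_and_continuousOn_iff_isDifferentiableOn hD]
  refine ⟨fun z w hzw => ?_, hc⟩
  rw [← add_eq_zero_iff_eq_neg, wedgeIntegral_add_wedgeIntegral_eq]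
  -- Cauchy's theorem for a rectangle whose interior misses the real axis
  have key : ∀ a b c d : ℝ, ([[a, b]] ×ℂ [[c, d]] ⊆ D) → (0 ≤ min c d ∨ max c d ≤ 0) →
      (∫ x : ℝ in a..b, h (x + c * I)) - (∫ x : ℝ in a..b, h (x + d * I)) +
      I • (∫ y : ℝ in c..d, h (b + y * I)) - I • (∫ y : ℝ in c..d, h (a + y * I)) = 0 := by
    intro a b c d hsub hcd
    have := integral_boundary_rect_eq_zero_of_continuousOn_of_differentiableOn h ⟨a, c⟩ ⟨b, d⟩
      (hc.mono hsub) (hd.mono ?_)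
    · simpa using this
    · intro p hp
      rw [mem_reProdIm] at hp
      refine ⟨hsub ?_, ?_⟩
      · rw [mem_reProdIm]
        exact ⟨Set.Ioo_subset_Icc_self hp.1, Set.Ioo_subset_Icc_self hp.2⟩
      · have h2 := hp.2
        simp only [Set.mem_Ioo] at h2
        intro h0
        simp only [Set.mem_ofPred_eq] at h0
        rcases hcd with h3 | h3 <;> linarith [h2.1, h2.2]
  have hsub : [[z.re, w.re]] ×ℂ [[z.im, w.im]] ⊆ D := hzw
  by_cases h0 : (0 : ℝ) ∈ [[z.im, w.im]]
  · have hs1 : [[z.im, 0]] ⊆ [[z.im, w.im]] := Set.uIcc_subset_uIcc Set.left_mem_uIcc h0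
    have hs2 : [[0, w.im]] ⊆ [[z.im, w.im]] := Set.uIcc_subset_uIcc h0 Set.right_mem_uIcc
    have k1 := key z.re w.re z.im 0 (fun p hp => hsub ⟨hp.1, hs1 hp.2⟩)
      (by rcases le_total 0 z.im with h | h <;> simp [h])
    have k2 := key z.re w.re 0 w.im (fun p hp => hsub ⟨hp.1, hs2 hp.2⟩)
      (by rcases le_total 0 w.im with h | h <;> simp [h])
    have hint : ∀ a ∈ [[z.re, w.re]], ∀ c d : ℝ, [[c, d]] ⊆ [[z.im, w.im]] →
        IntervalIntegrable (fun y : ℝ => h (a + y * I)) MeasureTheory.volume c d := by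
      intro a ha c d hcd
      refine ContinuousOn.intervalIntegrable (hc.comp (by fun_prop) fun y hy => hsub ?_)
      rw [mem_reProdIm]
      exact ⟨by simpa using ha, by simpa using hcd hy⟩
    have i1 := intervalIntegral.integral_add_adjacent_intervals
      (hint w.re Set.right_mem_uIcc _ _ hs1) (hint w.re Set.right_mem_uIcc _ _ hs2)
    have i2 := intervalIntegral.integral_add_adjacent_intervals
      (hint z.re Set.left_mem_uIcc _ _ hs1) (hint z.re Set.left_mem_uIcc _ _ hs2)
    rw [← i1, ← i2, smul_add, smul_add]
    linear_combination k1 + k2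
  · refine key z.re w.re z.im w.im hsub ?_
    rw [Set.uIcc, Set.mem_Icc, not_and_or, not_le, not_le] at h0
    rcases h0 with h0 | h0
    · exact Or.inl h0.le
    · exact Or.inr h0.le

/-! ### Slice functions from slice-by-slice holomorphic functions -/

theorem dAlpha_mul_left {c : Cl m} {g : ℂ → Cl m} {z : ℂ} (hg : DifferentiableAt ℝ g z) :
    dAlpha (fun w => c * g w) z = c * dAlpha g z := by
  have : HasFDerivAt (fun w => c * g w)
      ((LinearMap.toContinuousLinearMap (LinearMap.mulLeft ℝ c)).comp (fderiv ℝ g z)) z :=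
    (LinearMap.toContinuousLinearMap (LinearMap.mulLeft ℝ c)).hasFDerivAt.comp z hg.hasFDerivAt
  rw [dAlpha, this.fderiv]
  rfl

theorem dBeta_mul_left {c : Cl m} {g : ℂ → Cl m} {z : ℂ} (hg : DifferentiableAt ℝ g z) :
    dBeta (fun w => c * g w) z = c * dBeta g z := by
  have : HasFDerivAt (fun w => c * g w)
      ((LinearMap.toContinuousLinearMap (LinearMap.mulLeft ℝ c)).comp (fderiv ℝ g z)) z :=
    (LinearMap.toContinuousLinearMap (LinearMap.mulLeft ℝ c)).hasFDerivAt.comp z hg.hasFDerivAt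
  rw [dBeta, this.fderiv]
  rfl

theorem differentiableAt_mul_left {E : Type*} [NormedAddCommGroup E] [NormedSpace ℝ E] {c : Cl m}
    {g : E → Cl m} {z : E} (hg : DifferentiableAt ℝ g z) :
    DifferentiableAt ℝ (fun w => c * g w) z :=
  (LinearMap.toContinuousLinearMap (LinearMap.mulLeft ℝ c)).differentiableAt.comp z hg

theorem contDiffOn_mul_left {n : WithTop ℕ∞} {c : Cl m} {g : ℂ → Cl m} {D : Set ℂ}
    (hg : ContDiffOn ℝ n g D) : ContDiffOn ℝ n (fun w => c * g w) D :=
  (LinearMap.toContinuousLinearMap (LinearMap.mulLeft ℝ c)).contDiff.comp_contDiffOn hg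

/-- For a slice function, `∂̄_I` is the restriction to `ℂ_I` of `∂/∂x^c`. -/
theorem half_smul_dAlpha_add_mul_dBeta {I : Paravector m} (hI : I ∈ imUnits m)
    {F : ℂ → Cl m × Cl m} {z : ℂ} (hF : DifferentiableAt ℝ F z) :
    (1 / 2 : ℝ) • (dAlpha (fun w => (F w).1 + toCl m I * (F w).2) z +
      toCl m I * dBeta (fun w => (F w).1 + toCl m I * (F w).2) z) =
    (stemDbar F z).1 + toCl m I * (stemDbar F z).2 := by
  have h1 : DifferentiableAt ℝ (fun w => (F w).1) z := hF.fst
  have h2 : DifferentiableAt ℝ (fun w => (F w).2) z := hF.snd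
  have h3 : DifferentiableAt ℝ (fun w => toCl m I * (F w).2) z := differentiableAt_mul_left h2
  have ha : dAlpha (fun w => (F w).1 + toCl m I * (F w).2) z =
      dAlpha (fun w => (F w).1) z + toCl m I * dAlpha (fun w => (F w).2) z := by
    rw [← dAlpha_mul_left h2, dAlpha, fderiv_fun_add h1 h3]; rfl
  have hb : dBeta (fun w => (F w).1 + toCl m I * (F w).2) z =
      dBeta (fun w => (F w).1) z + toCl m I * dBeta (fun w => (F w).2) z := by
    rw [← dBeta_mul_left h2, dBeta, fderiv_fun_add h1 h3]; rfl
  rw [ha, hb, mul_add, toCl_mul_toCl_mul hI]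
  simp only [stemDbar, mul_smul_comm, ← smul_add, mul_add]
  congr 1
  abel

theorem dbar_eq_of_isInducedBy {D : Set ℂ} (hDo : IsOpen D) {f : Paravector m → Cl m}
    {F : ℂ → Cl m × Cl m} (hF : DifferentiableOn ℝ F D) (hfF : IsInducedBy D f F)
    {I : Paravector m} (hI : I ∈ imUnits m) {z : ℂ} (hz : z ∈ D) :
    dbar I f z = (stemDbar F z).1 + toCl m I * (stemDbar F z).2 := by
  rw [← half_smul_dAlpha_add_mul_dBeta hI (hF.differentiableAt (hDo.mem_nhds hz))]
  have : f ∘ phi I =ᶠ[nhds z] fun w => (F w).1 + toCl m I * (F w).2 := by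
    filter_upwards [hDo.mem_nhds hz] with w hw using hfF.2 w hw I hI
  rw [dbar, dAlpha, dBeta, this.fderiv_eq]
  rfl

/-- The stem function recovered from the slice `ℂ_J` by the representation formula:
`F_1 = (g(z) + g(z̄)) / 2` and `F_2 = J (g(z̄) - g(z)) / 2`, where `g = f ∘ φ_J`. -/
noncomputable def stemOfSlice (J : Paravector m) (f : Paravector m → Cl m) (z : ℂ) :
    Cl m × Cl m :=
  ((1 / 2 : ℝ) • (f (phi J z) + f (phi J (starRingEnd ℂ z))),
    (1 / 2 : ℝ) • (toCl m J * (f (phi J (starRingEnd ℂ z)) - f (phi J z))))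

theorem isStem_stemOfSlice (D : Set ℂ) (J : Paravector m) (f : Paravector m → Cl m) :
    IsStem D (stemOfSlice J f) := by
  intro z _
  constructor
  · simp only [stemOfSlice, Complex.conj_conj]
    rw [add_comm]
  · simp only [stemOfSlice, Complex.conj_conj]
    rw [← smul_neg, ← mul_neg, neg_sub]

theorem contDiffOn_stemOfSlice {n : WithTop ℕ∞} {D : Set ℂ}
    (hD : ∀ z ∈ D, starRingEnd ℂ z ∈ D) {J : Paravector m} {f : Paravector m → Cl m}
    (hf : ContDiffOn ℝ n (f ∘ phi J) D) : ContDiffOn ℝ n (stemOfSlice J f) D := by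
  have hc : ContDiffOn ℝ n (fun z => f (phi J (starRingEnd ℂ z))) D :=
    hf.comp Complex.conjCLE.contDiff.contDiffOn hD
  exact (ContDiffOn.const_smul _ (hf.add hc)).prodMk
    (ContDiffOn.const_smul _ (contDiffOn_mul_left (hc.sub hf)))

/-- The stem function recovered from a holomorphic slice satisfies the Cauchy-Riemann equations. -/
theorem stemDbar_stemOfSlice {D : Set ℂ} (hDo : IsOpen D) (hD : ∀ z ∈ D, starRingEnd ℂ z ∈ D)
    {J : Paravector m} (hJ : J ∈ imUnits m) {f : Paravector m → Cl m}
    (hf : DifferentiableOn ℝ (f ∘ phi J) D) (hd : ∀ z ∈ D, dbar J f z = 0) {z : ℂ} (hz : z ∈ D) :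
    stemDbar (stemOfSlice J f) z = 0 := by
  set g : ℂ → Cl m := f ∘ phi J with hg
  have hcr : ∀ w ∈ D, dAlpha g w = -(toCl m J * dBeta g w) := fun w hw => by
    have := hd w hw
    rw [dbar, smul_eq_zero] at this
    exact eq_neg_of_add_eq_zero_left (this.resolve_left (by norm_num))
  have h1 : HasFDerivAt g (fderiv ℝ g z) z :=
    (hf.differentiableAt (hDo.mem_nhds hz)).hasFDerivAt
  have h2' : HasFDerivAt g (fderiv ℝ g (starRingEnd ℂ z)) (Complex.conjCLE z) :=
    (hf.differentiableAt (hDo.mem_nhds (hD z hz))).hasFDerivAt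
  have h2 : HasFDerivAt (fun w => g (starRingEnd ℂ w))
      ((fderiv ℝ g (starRingEnd ℂ z)).comp (Complex.conjCLE : ℂ →L[ℝ] ℂ)) z :=
    h2'.comp z Complex.conjCLE.hasFDerivAt
  have hF1 : HasFDerivAt (fun w => (stemOfSlice J f w).1) _ z := (h1.add h2).const_smul (1 / 2 : ℝ)
  have hF2 : HasFDerivAt (fun w => (stemOfSlice J f w).2) _ z :=
    ((LinearMap.toContinuousLinearMap (LinearMap.mulLeft ℝ (toCl m J))).hasFDerivAt.comp z
      (h2.sub h1)).const_smul (1 / 2 : ℝ)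
  have e1 := hcr z hz
  have e2 := hcr _ (hD z hz)
  have e3 : ∀ w ∈ D, toCl m J * dAlpha g w = dBeta g w := fun w hw => by
    rw [hcr w hw, mul_neg, toCl_mul_toCl_mul hJ, neg_neg]
  have e4 := e3 z hz
  have e5 := e3 _ (hD z hz)
  simp only [dAlpha, dBeta] at e1 e2 e4 e5
  simp only [stemDbar, dAlpha, dBeta, hF1.fderiv, hF2.fderiv, Prod.mk_eq_zero]
  simp only [smul_apply, add_apply,
    sub_apply, ContinuousLinearMap.comp_apply,
    LinearMap.coe_toContinuousLinearMap', LinearMap.mulLeft_apply,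
    ContinuousLinearEquiv.coe_coe, Complex.conjCLE_apply, map_one, Complex.conj_I, map_neg,
    mul_sub, mul_neg, e4, e5]
  rw [e1, e2]
  constructor <;> module

/-- Two slices agree on the real points of `D`, so the identity theorem propagates the
representation formula from the real axis to all of `D`. -/
theorem isInducedBy_stemOfSlice {D : Set ℂ} (hDo : IsOpen D) (hDc : IsPreconnected D)
    (hD : ∀ z ∈ D, starRingEnd ℂ z ∈ D) {z₀ : ℂ} (hz₀ : z₀ ∈ D) (hz₀r : z₀.im = 0)
    {f : Paravector m → Cl m} (hf : SliceC1 D f)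
    (hd : ∀ I ∈ imUnits m, ∀ z ∈ D, dbar I f z = 0) {J : Paravector m} (hJ : J ∈ imUnits m) :
    IsInducedBy D f (stemOfSlice J f) := by
  refine ⟨isStem_stemOfSlice D J f, fun z hz I hI => ?_⟩
  have hJd : DifferentiableOn ℝ (f ∘ phi J) D := (hf J hJ).differentiableOn one_ne_zero
  have hId : DifferentiableOn ℝ (f ∘ phi I) D := (hf I hI).differentiableOn one_ne_zero
  have hFd : DifferentiableOn ℝ (stemOfSlice J f) D :=
    (contDiffOn_stemOfSlice hD (hf J hJ)).differentiableOn one_ne_zero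
  have hI2 := toCl_mul_self_of_mem_imUnits hI
  apply eq_of_forall_complexify_eq (toCl m I)
  intro L
  have hl : DifferentiableOn ℂ (fun w => complexify L (toCl m I) ((f ∘ phi I) w)) D := by
    intro w hw
    refine (differentiableAt_complexify hI2 (hId.differentiableAt (hDo.mem_nhds hw)) ?_
      L).differentiableWithinAt
    have := hd I hI w hw
    rw [dbar, smul_eq_zero] at this
    exact this.resolve_left (by norm_num)
  have hr : DifferentiableOn ℂ (fun w => complexify L (toCl m I)
      ((stemOfSlice J f w).1 + toCl m I * (stemOfSlice J f w).2)) D := by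
    intro w hw
    have hFw := hFd.differentiableAt (hDo.mem_nhds hw)
    have h2 : DifferentiableAt ℝ (fun w => (stemOfSlice J f w).2) w := hFw.snd
    refine (differentiableAt_complexify hI2
      (hFw.fst.add (differentiableAt_mul_left h2)) ?_ L).differentiableWithinAt
    have := half_smul_dAlpha_add_mul_dBeta hI hFw
    rw [stemDbar_stemOfSlice hDo hD hJ hJd (hd J hJ) hw] at this
    simp only [Prod.fst_zero, Prod.snd_zero, mul_zero, add_zero, smul_eq_zero] at this
    exact this.resolve_left (by norm_num)
  have key := (hl.analyticOnNhd hDo).eqOn_of_preconnected_of_frequently_eq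
    (hr.analyticOnNhd hDo) hDc hz₀ ?_
  · exact key hz
  -- the two functions agree at the real points, which accumulate at `z₀`
  · have ht : Filter.Tendsto (fun t : ℝ => z₀ + (t : ℂ)) (nhdsWithin 0 {0}ᶜ)
        (nhdsWithin z₀ {z₀}ᶜ) := by
      refine tendsto_nhdsWithin_of_tendsto_nhds_of_eventually_within _ ?_ ?_
      · have : Continuous fun t : ℝ => z₀ + (t : ℂ) := by fun_prop
        simpa using this.continuousWithinAt (s := {0}ᶜ) (x := 0) |>.tendsto
      · filter_upwards [self_mem_nhdsWithin] with t ht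
        simpa using ht
    refine ht.frequently (Filter.Eventually.frequently (Filter.Eventually.of_forall fun t => ?_))
    have hc : starRingEnd ℂ (z₀ + (t : ℂ)) = z₀ + (t : ℂ) := by
      apply Complex.ext <;> simp [hz₀r]
    have hp : phi I (z₀ + (t : ℂ)) = phi J (z₀ + (t : ℂ)) := by simp [phi, hz₀r]
    simp only [Function.comp_apply, stemOfSlice, hc, hp, sub_self, mul_zero, smul_zero, add_zero]
    congr 1
    module

/-! ### Regularity of slice functions -/

/-- If `f` is strictly differentiable at `x`, then `f - f'(x)` has small Lipschitz constant near
`x`, so the nearby derivatives are close to `f'(x)`. -/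
theorem contDiffOn_one_of_hasStrictFDerivAt {E F : Type*} [NormedAddCommGroup E] [NormedSpace ℝ E]
    [NormedAddCommGroup F] [NormedSpace ℝ F] {U : Set E} (hU : IsOpen U) {f : E → F}
    (h : ∀ x ∈ U, ∃ f' : E →L[ℝ] F, HasStrictFDerivAt f f' x) : ContDiffOn ℝ 1 f U := by
  have hd : ∀ x ∈ U, DifferentiableAt ℝ f x := fun x hx => by
    obtain ⟨f', hf'⟩ := h x hx
    exact hf'.differentiableAt
  rw [← zero_add (1 : WithTop ℕ∞), contDiffOn_succ_iff_fderiv_of_isOpen hU]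
  refine ⟨fun x hx => (hd x hx).differentiableWithinAt, by simp, ?_⟩
  rw [contDiffOn_zero]
  intro x hx
  apply ContinuousAt.continuousWithinAt
  obtain ⟨f', hf'⟩ := h x hx
  rw [Metric.continuousAt_iff', hf'.hasFDerivAt.fderiv]
  intro ε hε
  obtain ⟨s, hs, hfs⟩ := hf'.approximates_deriv_on_nhds (c := (ε / 2).toNNReal)
    (Or.inr (by simpa using hε))
  filter_upwards [eventually_mem_nhds_iff.2 hs, hU.mem_nhds hx] with y hy hyU
  have h1 : HasFDerivAt (f - ⇑f') (fderiv ℝ f y - f') y :=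
    (hd y hyU).hasFDerivAt.sub f'.hasFDerivAt
  have h2 := h1.le_of_lipschitzOn hy hfs.lipschitzOnWith
  rw [dist_eq_norm]
  rw [Real.coe_toNNReal _ (by positivity)] at h2
  linarith

theorem norm_proj_sub_le (x y : Paravector m) : ‖proj x - proj y‖ ≤ ‖x - y‖ := by
  rw [← sq_le_sq₀ (norm_nonneg _) (norm_nonneg _), norm_sq_eq_im (x - y), im_sub,
    Complex.sq_norm, Complex.normSq_apply]
  have h := sq_le_sq' (by linarith [abs_le.1 (abs_norm_sub_norm_le (im x) (im y))])
    (abs_le.1 (abs_norm_sub_norm_le (im x) (im y))).2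
  simp only [proj, Complex.sub_re, Complex.sub_im, PiLp.sub_apply]
  nlinarith

theorem norm_im_le (x : Paravector m) : ‖im x‖ ≤ ‖x‖ := by
  rw [← sq_le_sq₀ (norm_nonneg _) (norm_nonneg _), norm_sq_eq_im x]
  nlinarith [sq_nonneg (x 0)]

/-- The map `x ↦ Im(x) / |Im(x)|` has Lipschitz constant of order `2 / |Im(y)|` at `y`. -/
theorem norm_dir_sub_mul_le (x y : Paravector m) : ‖dir x - dir y‖ * ‖im y‖ ≤ 2 * ‖x - y‖ := by
  have h1 : ‖im y‖ • (dir x - dir y) = (‖im y‖ - ‖im x‖) • dir x + (im x - im y) := by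
    rw [smul_sub, norm_smul_dir y, sub_smul, norm_smul_dir x]
    abel
  have h2 : ‖im x - im y‖ ≤ ‖x - y‖ := by rw [← im_sub]; exact norm_im_le _
  have h3 : |‖im y‖ - ‖im x‖| ≤ ‖x - y‖ := by
    rw [abs_sub_comm]; exact (abs_norm_sub_norm_le _ _).trans h2
  calc ‖dir x - dir y‖ * ‖im y‖ = ‖‖im y‖ • (dir x - dir y)‖ := by
        rw [norm_smul, norm_norm, mul_comm]
    _ ≤ |‖im y‖ - ‖im x‖| * ‖dir x‖ + ‖im x - im y‖ := by
        rw [h1]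
        refine (norm_add_le _ _).trans_eq ?_
        rw [norm_smul, Real.norm_eq_abs]
    _ ≤ ‖x - y‖ * 1 + ‖x - y‖ := by
        gcongr
        exact norm_dir_le x
    _ = 2 * ‖x - y‖ := by ring

/-- The product `(x, a) ↦ x a` of a paravector and an element of `ℝ_m`. -/
noncomputable def mulL (m : ℕ) : Paravector m →L[ℝ] Cl m →L[ℝ] Cl m :=
  LinearMap.toContinuousLinearMap
    ((LinearMap.toContinuousLinearMap (𝕜 := ℝ) (E := Cl m) (F' := Cl m)).toLinearMap ∘ₗ
      LinearMap.mul ℝ (Cl m) ∘ₗ toCl m)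

theorem mulL_apply (x : Paravector m) (a : Cl m) : mulL m x a = toCl m x * a := rfl

theorem eq_neg_self_iff_eq_zero {a : Cl m} : a = -a ↔ a = 0 := by
  rw [eq_neg_iff_add_eq_zero, ← two_smul ℝ a, smul_eq_zero_iff_right two_ne_zero]

theorem fderiv_apply_I_eq_zero {f : ℂ → Cl m} {f' : ℂ →L[ℝ] Cl m} {z : ℂ}
    (hz : starRingEnd ℂ z = z) (hf : HasFDerivAt f f' z)
    (he : ∀ᶠ w in nhds z, f (starRingEnd ℂ w) = f w) : f' Complex.I = 0 := by
  have h1 : HasFDerivAt f f' (Complex.conjCLE z) := by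
    rwa [Complex.conjCLE_apply, hz]
  have h2 : HasFDerivAt f (f'.comp (Complex.conjCLE : ℂ →L[ℝ] ℂ)) z :=
    (h1.comp z Complex.conjCLE.hasFDerivAt).congr_of_eventuallyEq
      (he.mono fun w hw => by simp [hw])
  have h3 := congrArg (fun T : ℂ →L[ℝ] Cl m => T Complex.I) (hf.unique h2)
  simp only [ContinuousLinearMap.comp_apply, ContinuousLinearEquiv.coe_coe,
    Complex.conjCLE_apply, Complex.conj_I, map_neg] at h3
  exact eq_neg_self_iff_eq_zero.1 h3

theorem fderiv_apply_one_eq_zero {f : ℂ → Cl m} {f' : ℂ →L[ℝ] Cl m} {z : ℂ}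
    (hz : starRingEnd ℂ z = z) (hf : HasFDerivAt f f' z)
    (he : ∀ᶠ w in nhds z, f (starRingEnd ℂ w) = -f w) : f' 1 = 0 := by
  have h1 : HasFDerivAt f f' (Complex.conjCLE z) := by
    rwa [Complex.conjCLE_apply, hz]
  have h2 : HasFDerivAt f (-(f'.comp (Complex.conjCLE : ℂ →L[ℝ] ℂ))) z :=
    (h1.comp z Complex.conjCLE.hasFDerivAt).neg.congr_of_eventuallyEq
      (he.mono fun w hw => by simp [hw])
  have h3 := congrArg (fun T : ℂ →L[ℝ] Cl m => T 1) (hf.unique h2)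
  simp only [ContinuousLinearMap.comp_apply, ContinuousLinearEquiv.coe_coe,
    neg_apply, Complex.conjCLE_apply, map_one] at h3
  exact eq_neg_self_iff_eq_zero.1 h3

theorem apply_eq_re_smul_add_im_smul (T : ℂ →L[ℝ] Cl m) (z : ℂ) :
    T z = z.re • T 1 + z.im • T Complex.I := by
  rw [← map_smul, ← map_smul, ← map_add]
  congr 1
  apply Complex.ext <;> simp

theorem tendsto_proj_prod (x : Paravector m) :
    Filter.Tendsto (fun p : Paravector m × Paravector m => (proj p.1, proj p.2)) (nhds (x, x))
      (nhds (proj x, proj x)) := by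
  have h := continuous_proj (m := m)
  have : Continuous fun p : Paravector m × Paravector m => (proj p.1, proj p.2) := by fun_prop
  exact this.tendsto (x, x)

/-- The even component of a stem function has no `β`-derivative on the real axis, so its first
order expansion involves `x_0` only. -/
theorem hasStrictFDerivAt_comp_proj {f : ℂ → Cl m} {f' : ℂ →L[ℝ] Cl m} {x : Paravector m}
    (hf : HasStrictFDerivAt f f' (proj x)) (h0 : f' Complex.I = 0) :
    HasStrictFDerivAt (fun y => f (proj y))
      ((EuclideanSpace.proj (0 : Fin (m + 1)) : Paravector m →L[ℝ] ℝ).smulRight (f' 1)) x := by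
  have h1 := hf.isLittleO.comp_tendsto (tendsto_proj_prod x)
  refine HasStrictFDerivAt.of_isLittleO ?_
  refine (h1.congr_left fun p => ?_).trans_isBigO
    (Asymptotics.isBigO_of_le _ fun p => norm_proj_sub_le p.1 p.2)
  simp only [Function.comp_apply]
  rw [apply_eq_re_smul_add_im_smul f', h0]
  simp [proj]

/-- With `f(z) = Im(z) b + R(z)` the function is `Im(x) b + (Im(x) / |Im(x)|) R`. The remainder
`R` has small Lipschitz constant near the real axis and vanishes there, which compensates the
Lipschitz constant `2 / |Im(x)|` of `Im(x) / |Im(x)|`. -/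
theorem hasStrictFDerivAt_dir_mul_comp_proj {f : ℂ → Cl m} {f' : ℂ →L[ℝ] Cl m} {x : Paravector m}
    (hx : im x = 0) (hf : HasStrictFDerivAt f f' (proj x)) (h1 : f' 1 = 0)
    (hr : ∀ᶠ w in nhds (proj x), w.im = 0 → f w = 0) :
    HasStrictFDerivAt (fun y => toCl m (dir y) * f (proj y))
      (((mulL m).flip (f' Complex.I)).comp (imL m)) x := by
  set b := f' Complex.I with hb
  set R : ℂ → Cl m := fun z => f z - z.im • b with hR
  have hf' : ∀ z, f' z = z.im • b := fun z => by
    rw [apply_eq_re_smul_add_im_smul f', h1, smul_zero, zero_add]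
  refine HasStrictFDerivAt.of_isLittleO ?_
  rw [Asymptotics.isLittleO_iff]
  intro ε hε
  set C := ‖mulL m‖ with hC
  have hC0 : 0 ≤ C := norm_nonneg (mulL m)
  -- the two error terms below contribute `C δ` and `2 C δ`
  set δ := ε / (3 * (C + 1)) with hδ
  have hδ0 : 0 < δ := by positivity
  have hRe : ∀ᶠ p : ℂ × ℂ in nhds (proj x, proj x), ‖R p.1 - R p.2‖ ≤ δ * ‖p.1 - p.2‖ := by
    filter_upwards [Asymptotics.isLittleO_iff.1 hf.isLittleO hδ0] with p hp
    have e : R p.1 - R p.2 = f p.1 - f p.2 - f' (p.1 - p.2) := by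
      rw [hf', hR]
      simp only [Complex.sub_im, sub_smul]
      abel
    rw [e]
    exact hp
  have e1 := (tendsto_proj_prod x).eventually hRe
  -- comparing `proj v` with the real point below it bounds `R (proj v)` by `δ |Im(v)|`
  have hcont : Continuous fun p : Paravector m × Paravector m => (proj p.2, ((p.2 0 : ℝ) : ℂ)) := by
    have := continuous_proj (m := m)
    fun_prop
  have hxr : ((x 0 : ℝ) : ℂ) = proj x := by
    apply Complex.ext <;> simp [proj, hx]
  have ht := hcont.tendsto (x, x)
  simp only [hxr] at ht
  have e2 := ht.eventually hRe
  have e3 := (((continuous_snd.comp hcont).tendsto (x, x)).eventually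
    (show ∀ᶠ w in nhds ((x 0 : ℝ) : ℂ), w.im = 0 → f w = 0 by rwa [hxr]))
  filter_upwards [e1, e2, e3] with p hp1 hp2 hp3
  obtain ⟨u, v⟩ := p
  simp only [Function.comp_apply, Complex.ofReal_im, forall_const] at hp1 hp2 hp3
  have hRv : ‖R (proj v)‖ ≤ δ * ‖im v‖ := by
    have hR0 : R ((v 0 : ℝ) : ℂ) = 0 := by simp [hR, hp3]
    rw [hR0, sub_zero] at hp2
    have : proj v - ((v 0 : ℝ) : ℂ) = ((‖im v‖ : ℝ) : ℂ) * Complex.I := by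
      apply Complex.ext <;> simp [proj]
    rw [this, norm_mul, Complex.norm_I, mul_one, Complex.norm_real, norm_norm] at hp2
    exact hp2
  have hsplit : ∀ y : Paravector m,
      toCl m (dir y) * f (proj y) = mulL m (dir y) (R (proj y)) + mulL m (im y) b := by
    intro y
    have : toCl m (im y) = ‖im y‖ • toCl m (dir y) := by rw [← map_smul, norm_smul_dir]
    rw [mulL_apply, mulL_apply, this, hR]
    simp only [proj, mul_sub, mul_smul_comm, smul_mul_assoc]
    abel
  have heq : toCl m (dir u) * f (proj u) - toCl m (dir v) * f (proj v) -
      (((mulL m).flip b).comp (imL m)) (u - v) =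
      mulL m (dir u) (R (proj u) - R (proj v)) + mulL m (dir u - dir v) (R (proj v)) := by
    rw [hsplit, hsplit, ContinuousLinearMap.comp_apply, imL_apply, im_sub,
      ContinuousLinearMap.flip_apply]
    simp only [map_sub, sub_apply]
    abel
  have hb1 : ‖mulL m (dir u) (R (proj u) - R (proj v))‖ ≤ C * 1 * (δ * ‖u - v‖) := by
    refine ((mulL m).le_opNorm₂ _ _).trans ?_
    gcongr
    · exact norm_dir_le u
    · exact hp1.trans (by gcongr; exact norm_proj_sub_le u v)
  have hb2 : ‖mulL m (dir u - dir v) (R (proj v))‖ ≤ C * δ * (2 * ‖u - v‖) := by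
    refine ((mulL m).le_opNorm₂ _ _).trans ?_
    calc C * ‖dir u - dir v‖ * ‖R (proj v)‖ ≤ C * ‖dir u - dir v‖ * (δ * ‖im v‖) := by gcongr
      _ = C * δ * (‖dir u - dir v‖ * ‖im v‖) := by ring
      _ ≤ C * δ * (2 * ‖u - v‖) := by
        exact mul_le_mul_of_nonneg_left (norm_dir_sub_mul_le u v) (by positivity)
  have hCδ : 3 * C * δ ≤ ε := by
    have : 3 * (C + 1) * δ = ε := by rw [hδ]; field_simp
    nlinarith
  change ‖toCl m (dir u) * f (proj u) - toCl m (dir v) * f (proj v) -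
      (((mulL m).flip b).comp (imL m)) (u - v)‖ ≤ ε * ‖u - v‖
  rw [heq]
  calc _ ≤ C * 1 * (δ * ‖u - v‖) + C * δ * (2 * ‖u - v‖) := norm_add_le_of_le hb1 hb2
    _ = 3 * C * δ * ‖u - v‖ := by ring
    _ ≤ ε * ‖u - v‖ := by gcongr

theorem contDiffAt_proj {n : WithTop ℕ∞} {x : Paravector m} (hx : im x ≠ 0) :
    ContDiffAt ℝ n (proj : Paravector m → ℂ) x := by
  have h1 : (proj : Paravector m → ℂ) =
      fun x => ((x 0 : ℝ) : ℂ) + ((‖imL m x‖ : ℝ) : ℂ) * Complex.I := by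
    ext1 x
    apply Complex.ext <;> simp [proj, imL_apply]
  rw [h1]
  have h2 : ContDiffAt ℝ n (fun x : Paravector m => ((x 0 : ℝ) : ℂ)) x :=
    (Complex.ofRealCLM.comp
      (EuclideanSpace.proj (0 : Fin (m + 1)) : Paravector m →L[ℝ] ℝ)).contDiff.contDiffAt
  have h3 : ContDiffAt ℝ n (fun x : Paravector m => ‖imL m x‖) x :=
    (imL m).contDiff.contDiffAt.norm ℝ (by rwa [imL_apply])
  exact h2.add ((Complex.ofRealCLM.contDiff.contDiffAt.comp x h3).mul contDiffAt_const)

theorem contDiffAt_dir {n : WithTop ℕ∞} {x : Paravector m} (hx : im x ≠ 0) :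
    ContDiffAt ℝ n (dir : Paravector m → Paravector m) x := by
  have h1 : (dir : Paravector m → Paravector m) = fun x => ‖imL m x‖⁻¹ • imL m x := by
    ext1 x
    rw [imL_apply]; rfl
  rw [h1]
  have h3 : ContDiffAt ℝ n (fun x : Paravector m => ‖imL m x‖) x :=
    (imL m).contDiff.contDiffAt.norm ℝ (by rwa [imL_apply])
  exact (h3.inv (by rwa [imL_apply, norm_ne_zero_iff])).smul (imL m).contDiff.contDiffAt

/-- A slice function expressed through the projection to the closed upper half plane. On the real
axis `dir x = 0`, which is consistent because `F_2` vanishes there. -/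
theorem IsInducedBy.eq_proj_dir {D : Set ℂ} (hm : 0 < m) (hD : ∀ z ∈ D, starRingEnd ℂ z ∈ D)
    {f : Paravector m → Cl m} {F : ℂ → Cl m × Cl m} (hfF : IsInducedBy D f F) {x : Paravector m}
    (hx : x ∈ circularization m D) :
    f x = (F (proj x)).1 + toCl m (dir x) * (F (proj x)).2 := by
  have hp := proj_mem hD hx
  by_cases h : im x = 0
  · obtain ⟨I, hI⟩ := imUnits_nonempty hm
    have h1 := hfF.2 _ hp I hI
    have hc : starRingEnd ℂ (proj x) = proj x := by
      apply Complex.ext <;> simp [proj, h]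
    have h2 := (hfF.1 _ hp).2
    rw [hc, eq_neg_self_iff_eq_zero] at h2
    rw [phi_proj_of_im_eq_zero I h, h2] at h1
    rw [h1, h2]
    simp
  · have h1 := hfF.2 _ hp _ (dir_mem_imUnits h)
    rwa [phi_dir_proj] at h1

/-- A slice function induced by a stem function of class `C¹` is of class `C¹`, also across the
real axis. -/
theorem IsInducedBy.contDiffOn {D : Set ℂ} (hm : 0 < m) (hDo : IsOpen D)
    (hD : ∀ z ∈ D, starRingEnd ℂ z ∈ D) (hΩ : IsOpen (circularization m D))
    {f : Paravector m → Cl m} {F : ℂ → Cl m × Cl m} (hF : ContDiffOn ℝ 1 F D)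
    (hfF : IsInducedBy D f F) : ContDiffOn ℝ 1 f (circularization m D) := by
  refine contDiffOn_one_of_hasStrictFDerivAt hΩ fun x hx => ?_
  have hp := proj_mem hD hx
  have hFx : ContDiffAt ℝ 1 F (proj x) := hF.contDiffAt (hDo.mem_nhds hp)
  have hev : (fun y => (F (proj y)).1 + toCl m (dir y) * (F (proj y)).2) =ᶠ[nhds x] f := by
    filter_upwards [hΩ.mem_nhds hx] with y hy using (hfF.eq_proj_dir hm hD hy).symm
  suffices h : ∃ f' : Paravector m →L[ℝ] Cl m,
      HasStrictFDerivAt (fun y => (F (proj y)).1 + toCl m (dir y) * (F (proj y)).2) f' x by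
    obtain ⟨f', hf'⟩ := h
    exact ⟨f', hf'.congr_of_eventuallyEq hev⟩
  by_cases h : im x = 0
  · have hDp : ∀ᶠ w in nhds (proj x), w ∈ D := hDo.mem_nhds hp
    have hc : starRingEnd ℂ (proj x) = proj x := by
      apply Complex.ext <;> simp [proj, h]
    have s1 : HasStrictFDerivAt (fun w => (F w).1) _ (proj x) :=
      hFx.fst.hasStrictFDerivAt one_ne_zero
    have s2 : HasStrictFDerivAt (fun w => (F w).2) _ (proj x) :=
      hFx.snd.hasStrictFDerivAt one_ne_zero
    have t1 := fderiv_apply_I_eq_zero hc s1.hasFDerivAt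
      (hDp.mono fun w hw => (hfF.1 w hw).1)
    have t2 := fderiv_apply_one_eq_zero hc s2.hasFDerivAt
      (hDp.mono fun w hw => (hfF.1 w hw).2)
    refine ⟨_, (hasStrictFDerivAt_comp_proj s1 t1).add
      (hasStrictFDerivAt_dir_mul_comp_proj h s2 t2 ?_)⟩
    filter_upwards [hDo.mem_nhds hp] with w hw hw0
    have h2 := (hfF.1 w hw).2
    rwa [Complex.conj_eq_iff_im.2 hw0, eq_neg_self_iff_eq_zero] at h2
  · have hcd : ContDiffAt ℝ 1
        (fun y => (F (proj y)).1 + toCl m (dir y) * (F (proj y)).2) x := by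
      have hc := hFx.comp x (contDiffAt_proj h)
      exact hc.fst.add
        (((mulL m).contDiff.contDiffAt.comp x (contDiffAt_dir h)).clm_apply hc.snd)
    exact ⟨_, hcd.hasStrictFDerivAt one_ne_zero⟩

/-! ### The differential operators on the slices -/

theorem sum_smul_unit_succ (x : Paravector m) : ∑ h : Fin m, x h.succ • unit h.succ = im x := by
  ext i
  refine Fin.cases ?_ (fun j => ?_) i
  · simp [unit, Fin.succ_ne_zero, eq_comm]
  · simp [unit, Pi.single_apply]

theorem sum_smul_partialDeriv (g : Paravector m → Cl m) (x : Paravector m) :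
    ∑ h : Fin m, x h.succ • partialDeriv h.succ g x = fderiv ℝ g x (im x) := by
  rw [← sum_smul_unit_succ, map_sum]
  simp only [map_smul, partialDeriv]

/-- Off the real axis, `ϑ̄_m` restricts to `∂̄_I` on every slice. -/
theorem thetaBar_phi {f : Paravector m → Cl m} {I : Paravector m} (hI : I ∈ imUnits m) {z : ℂ}
    (hz : z.im ≠ 0) (hf : DifferentiableAt ℝ f (phi I z)) :
    thetaBar f (phi I z) = dbar I f z := by
  have h1 : HasFDerivAt (f ∘ phi I) ((fderiv ℝ f (phi I z)).comp (phiL I)) z := by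
    have := (phiL I).hasFDerivAt (x := z)
    rw [coe_phiL] at this
    exact hf.hasFDerivAt.comp z this
  have hn : ‖im (phi I z)‖ ^ 2 = z.im ^ 2 := by
    rw [im_phi hI, norm_smul, (mem_imUnits_iff.1 hI).2, mul_one, Real.norm_eq_abs, sq_abs]
  rw [thetaBar, dbar, sum_smul_partialDeriv, dAlpha, dBeta, h1.fderiv, hn, im_phi hI]
  simp only [ContinuousLinearMap.comp_apply, coe_phiL, map_smul, smul_mul_assoc, mul_smul_comm,
    smul_smul, partialDeriv]
  have h2 : (z.im ^ 2)⁻¹ * (z.im * z.im) = 1 := by field_simp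
  rw [h2, one_smul]
  simp [phi]

theorem opG_eq {f : Paravector m → Cl m} {x : Paravector m} (hx : im x ≠ 0) :
    opG f x = (2 * ‖im x‖ ^ 2) • thetaBar f x := by
  have h : ‖im x‖ ≠ 0 := norm_ne_zero_iff.2 hx
  rw [opG, thetaBar, smul_smul, smul_add, smul_smul]
  have h1 : 2 * ‖im x‖ ^ 2 * (1 / 2) = ‖im x‖ ^ 2 := by ring
  have h2 : ‖im x‖ ^ 2 * (‖im x‖ ^ 2)⁻¹ = 1 := mul_inv_cancel₀ (pow_ne_zero 2 h)
  rw [h1, h2, one_smul]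

theorem opG_eq_zero_of_im_eq_zero {f : Paravector m → Cl m} {x : Paravector m} (hx : im x = 0) :
    opG f x = 0 := by
  simp [opG, hx]

theorem isClosed_realAxis (m : ℕ) : IsClosed (realAxis m) :=
  isClosed_singleton.preimage continuous_im (Y := Paravector m)

theorem exists_phi_of_mem_diff {D : Set ℂ} {x : Paravector m}
    (hx : x ∈ circularization m D \ realAxis m) :
    ∃ z ∈ D, ∃ I ∈ imUnits m, z.im ≠ 0 ∧ x = phi I z := by
  obtain ⟨⟨z, hz, I, hI, rfl⟩, hr⟩ := hx
  exact ⟨z, hz, I, hI, fun h => hr ((phi_mem_realAxis_iff hI).2 h), rfl⟩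

/-- The complexified coordinates of `f ∘ φ_I` are continuous, and holomorphic off the real axis,
hence holomorphic. -/
theorem contDiffOn_and_dbar_eq_zero_of_sliceContinuous {D : Set ℂ} (hDo : IsOpen D)
    (hΩ : IsOpen (circularization m D)) {f : Paravector m → Cl m}
    (hc : SliceContinuous (circularization m D) f)
    (hf : ContDiffOn ℝ 1 f (circularization m D \ realAxis m))
    (ht : ∀ x ∈ circularization m D \ realAxis m, thetaBar f x = 0) {I : Paravector m}
    (hI : I ∈ imUnits m) :
    ContDiffOn ℝ 1 (f ∘ phi I) D ∧ ∀ z ∈ D, dbar I f z = 0 := by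
  have hI2 := toCl_mul_self_of_mem_imUnits hI
  have hcI : ContinuousOn (f ∘ phi I) D :=
    (hc I hI).comp (continuous_phi I).continuousOn fun z hz =>
      ⟨phi_mem_circularization hz hI, z, rfl⟩
  have hol : ∀ L : Cl m →ₗ[ℝ] ℝ,
      DifferentiableOn ℂ (fun w => complexify L (toCl m I) ((f ∘ phi I) w)) D := by
    intro L
    refine differentiableOn_of_differentiableOn_diff_real hDo
      ((complexify L (toCl m I)).continuous.comp_continuousOn hcI) fun z hz => ?_
    have hmem : phi I z ∈ circularization m D \ realAxis m :=
      ⟨phi_mem_circularization hz.1 hI, fun h => hz.2 ((phi_mem_realAxis_iff hI).1 h)⟩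
    have hfd : DifferentiableAt ℝ f (phi I z) :=
      (hf.differentiableOn one_ne_zero).differentiableAt
        ((hΩ.sdiff (isClosed_realAxis m)).mem_nhds hmem)
    have hgd : DifferentiableAt ℝ (f ∘ phi I) z := by
      have := (phiL I).differentiableAt (x := z)
      rw [coe_phiL] at this
      exact hfd.comp z this
    refine (differentiableAt_complexify hI2 hgd ?_ L).differentiableWithinAt
    have h0 := ht _ hmem
    rw [thetaBar_phi hI hz.2 hfd, dbar, smul_eq_zero] at h0
    exact h0.resolve_left (by norm_num)
  have hC1 : ContDiffOn ℝ 1 (f ∘ phi I) D := contDiffOn_of_forall_complexify hDo hol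
  refine ⟨hC1, fun z hz => ?_⟩
  rw [dbar, dAlpha_add_mul_dBeta_eq_zero hI2
    ((hC1.differentiableOn one_ne_zero).differentiableAt (hDo.mem_nhds hz))
    fun L => (hol L).differentiableAt (hDo.mem_nhds hz), smul_zero]

theorem hasSliceDbar_zero_of_sliceC1 {D : Set ℂ} (hm : 0 < m) (hDo : IsOpen D)
    (hDc : IsPreconnected D) (hD : ∀ z ∈ D, starRingEnd ℂ z ∈ D) {z₀ : ℂ} (hz₀ : z₀ ∈ D)
    (hz₀r : z₀.im = 0) {f : Paravector m → Cl m} (hf : SliceC1 D f)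
    (hd : ∀ I ∈ imUnits m, ∀ z ∈ D, dbar I f z = 0) : HasSliceDbar D f (fun _ => 0) := by
  obtain ⟨J, hJ⟩ := imUnits_nonempty hm
  have h0 : ∀ z ∈ D, stemDbar (stemOfSlice J f) z = 0 := fun z hz =>
    stemDbar_stemOfSlice hDo hD hJ ((hf J hJ).differentiableOn one_ne_zero) (hd J hJ) hz
  refine ⟨stemOfSlice J f, contDiffOn_stemOfSlice hD (hf J hJ),
    isInducedBy_stemOfSlice hDo hDc hD hz₀ hz₀r hf hd hJ, fun z hz => ?_, fun z hz I _ => ?_⟩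
  · simp [h0 z hz, h0 _ (hD z hz)]
  · simp [h0 z hz]

end SliceMonogenic

theorem mainTheorem7 (m : ℕ) (hm : 2 ≤ m)
    (D : Set ℂ) (hD : ∀ z ∈ D, starRingEnd ℂ z ∈ D)
    (Ω : Set (SliceMonogenic.Paravector m)) (hΩD : Ω = SliceMonogenic.circularization m D)
    (hΩopen : IsOpen Ω) (hΩconn : IsConnected Ω)
    (hΩreal : (Ω ∩ SliceMonogenic.realAxis m).Nonempty)
    (f : SliceMonogenic.Paravector m → SliceMonogenic.Cl m) :
    List.TFAE [
      SliceMonogenic.IsSliceMonogenic D Ω f,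
      SliceMonogenic.SliceC1 D f ∧
        ∀ I ∈ SliceMonogenic.imUnits m, ∀ z ∈ D, SliceMonogenic.dbar I f z = 0,
      ContinuousOn f Ω ∧ ContDiffOn ℝ 1 f (Ω \ SliceMonogenic.realAxis m) ∧
        ∀ x ∈ Ω \ SliceMonogenic.realAxis m, SliceMonogenic.thetaBar f x = 0,
      SliceMonogenic.SliceContinuous Ω f ∧ ContDiffOn ℝ 1 f (Ω \ SliceMonogenic.realAxis m) ∧
        ∀ x ∈ Ω \ SliceMonogenic.realAxis m, SliceMonogenic.thetaBar f x = 0,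
      ContDiffOn ℝ 1 f Ω ∧
        ∀ x ∈ Ω \ SliceMonogenic.realAxis m, SliceMonogenic.thetaBar f x = 0,
      ContDiffOn ℝ 1 f Ω ∧ ∀ x ∈ Ω, SliceMonogenic.opG f x = 0,
      SliceMonogenic.HasSliceDbar D f (fun _ => 0)] := by
  subst hΩD
  have hm0 : 0 < m := by omega
  have hDo := SliceMonogenic.isOpen_of_isOpen_circularization hm0 hD hΩopen
  have hDc := SliceMonogenic.isPreconnected_of_circularization hm0 hD hΩconn.isPreconnected hΩreal
  obtain ⟨z₀, hz₀, hz₀r⟩ : ∃ z ∈ D, z.im = 0 := by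
    obtain ⟨x, ⟨z, hz, I, hI, rfl⟩, hx⟩ := hΩreal
    exact ⟨z, hz, (SliceMonogenic.phi_mem_realAxis_iff hI).1 hx⟩
  tfae_have 1 → 5 := by
    rintro ⟨h1, h2⟩
    refine ⟨h1, fun x hx => ?_⟩
    obtain ⟨z, hz, I, hI, hz0, rfl⟩ := SliceMonogenic.exists_phi_of_mem_diff hx
    rw [SliceMonogenic.thetaBar_phi hI hz0
      ((h1.differentiableOn one_ne_zero).differentiableAt (hΩopen.mem_nhds hx.1)), h2 I hI z hz]
  tfae_have 5 → 6 := by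
    rintro ⟨h1, h2⟩
    refine ⟨h1, fun x hx => ?_⟩
    by_cases hxr : SliceMonogenic.im x = 0
    · exact SliceMonogenic.opG_eq_zero_of_im_eq_zero hxr
    · rw [SliceMonogenic.opG_eq hxr, h2 x ⟨hx, hxr⟩, smul_zero]
  tfae_have 6 → 3 := by
    rintro ⟨h1, h2⟩
    refine ⟨h1.continuousOn, h1.mono Set.sdiff_subset, fun x hx => ?_⟩
    have hxr : SliceMonogenic.im x ≠ 0 := hx.2
    have h3 := h2 x hx.1
    rw [SliceMonogenic.opG_eq hxr, smul_eq_zero] at h3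
    have : ‖SliceMonogenic.im x‖ ≠ 0 := norm_ne_zero_iff.2 hxr
    exact h3.resolve_left (by positivity)
  tfae_have 3 → 4 := by
    rintro ⟨h1, h2⟩
    exact ⟨fun I _ => h1.mono Set.inter_subset_left, h2⟩
  tfae_have 4 → 2 := by
    rintro ⟨h1, h2, h3⟩
    have h := fun I hI => SliceMonogenic.contDiffOn_and_dbar_eq_zero_of_sliceContinuous
      hDo hΩopen h1 h2 h3 (I := I) hI
    exact ⟨fun I hI => (h I hI).1, fun I hI => (h I hI).2⟩
  tfae_have 2 → 7 := by
    rintro ⟨h1, h2⟩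
    exact SliceMonogenic.hasSliceDbar_zero_of_sliceC1 hm0 hDo hDc hD hz₀ hz₀r h1 h2
  tfae_have 7 → 1 := by
    rintro ⟨F, hF, hfF, h0⟩
    refine ⟨hfF.contDiffOn hm0 hDo hD hΩopen hF, fun I hI z hz => ?_⟩
    rw [SliceMonogenic.dbar_eq_of_isInducedBy hDo (hF.differentiableOn one_ne_zero) hfF hI hz]
    exact (h0.2 z hz I hI).symm
  tfae_finish
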